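/- Let $k$ be a positive integer, let $\mathbb{F}_{2^{2k}}$ be the finite field with $2^{2k}$ elements, and let $Tr_1^{2k}$ denote the trace function from $\mathbb{F}_{2^{2k}}$ to $\mathbb{F}_2$. A function $f:\mathbb{F}_{2^{2k}}\to\mathbb{F}_2$ is called bent if $$\widehat f(\lambda)=\sum_{x\in\mathbb{F}_{2^{2k}}}(-1)^{f(x)+Tr_1^{2k}(\lambda x)}\in\{2^k,-2^k\}\quad\text{for every }\lambda\in\mathbb{F}_{2^{2k}}.$$ Let $d=(2^k+1)s$, where $s$ is an integer with $0<s<2^k-1$. If $\gcd(s,2^k-1)=1$ and $s\notin\{1,2,2^2,\dots,2^{k-1}\}$, then for every $\alpha\in\mathbb{F}_{2^{2k}}$ the function $f(x)=Tr_1^{2k}(\alpha x^d)$ is not bent. -/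

import Mathlib

/-- The Hadamard (Walsh) transform of a Boolean function `f : F → 𝔽₂` on a finite field `F` of
characteristic two: `λ ↦ ∑ x, (-1) ^ (f x + Tr (λ x))`, where `Tr` is the absolute trace
`F → 𝔽₂` and the exponent is represented by its value in `{0, 1}`. -/
noncomputable def hadamardTransform {F : Type*} [Field F] [Fintype F] [Algebra (ZMod 2) F]
    (f : F → ZMod 2) (l : F) : ℤ :=
  ∑ x : F, (-1 : ℤ) ^ (f x + Algebra.trace (ZMod 2) F (l * x)).val

/-- A Boolean function on the finite field `F` with `2 ^ n` elements is bent if all values of its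
Hadamard transform are `2 ^ (n / 2)` or `-2 ^ (n / 2)`; here `n` is the degree of `F` over `𝔽₂`. -/
def IsBent {F : Type*} [Field F] [Fintype F] [Algebra (ZMod 2) F] (f : F → ZMod 2) : Prop :=
  ∀ l : F,
    (hadamardTransform f l : ℝ) = (2 : ℝ) ^ ((Module.finrank (ZMod 2) F : ℝ) / 2) ∨
    (hadamardTransform f l : ℝ) = -(2 : ℝ) ^ ((Module.finrank (ZMod 2) F : ℝ) / 2)

/-! Put q = 2^k, let K be the subfield of F with q elements, χ its trace character, N the norm from
F to K, and Kl the Kloosterman sum of K. Since x^(q+1) = N(x), the function is Tr(A N(x)^s), where A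
is the relative trace of α. Its transform at l ≠ 0 is therefore 1 plus a multiplicative correlation
on Kˣ of z ↦ χ(A z^s) with the norm fibre sums, which equal -Kl
(`normFiberSum_eq_neg_kloostermanSum`). Such a correlation can be inverted, so bentness yields signs
ε with ∑_y ε(c/y) χ(y^s) = Kl(c) (`exists_sign_of_bent`).

Such signs constrain s twice. First, Kl is the multiplicative convolution of χ with itself, so the
inverse Teichmüller character turns the identity into E G_s = G_1^2 in the Witt vectors of K, with E
integral and G_s the sum of χ(y^s) against that character. Here G_1 is exactly divisible by 2,
whereas 8 divides G_s unless s (2^i + 2^j) ≡ 1 mod q - 1 for some i ≤ j.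

Second, put m = j - i and let σ invert y ↦ y^(1 + 2^m). Then Kl(c) - 1 is the convolution of χ ∘ σ
with the number n(c) of roots of x (1 + x)^(2^m) = c (`kloostermanSum_eq_sum_fiberCard`). Inverting
again, ε - n is constant, so n takes only the values 0 and 2. If the 2^m-power map moved a point,
some fibre would have at least three elements (`pow_two_pow_eq_self_of_fiberCard`). So that map is
the identity, s 2^(i+1) ≡ 1, and s is a power of two. -/

/-- The canonical additive character `x ↦ (-1) ^ Tr x` of a field of characteristic two. -/
noncomputable def traceChar (K : Type*) [Field K] [Algebra (ZMod 2) K] : AddChar K ℤ where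
  toFun x := (-1) ^ (Algebra.trace (ZMod 2) K x).val
  map_zero_eq_one' := by simp
  map_add_eq_mul' x y := by
    rw [map_add]
    generalize Algebra.trace (ZMod 2) K x = a
    generalize Algebra.trace (ZMod 2) K y = b
    revert a b
    decide

/-- A sum over a finite field is the term at zero plus the sum over the units. -/
lemma sum_eq_add_sum_units {K M : Type*} [Field K] [Fintype K] [Fintype Kˣ] [AddCommMonoid M]
    (f : K → M) : ∑ x, f x = f 0 + ∑ x : Kˣ, f x := by
  classical
  rw [← Finset.add_sum_erase _ _ (Finset.mem_univ (0 : K))]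
  congr 1
  refine (Finset.sum_bij (fun (x : Kˣ) _ ↦ (x : K)) ?_ ?_ ?_ ?_).symm
  · simp
  · exact fun _ _ _ _ h ↦ Units.ext h
  · intro b hb
    exact ⟨Units.mk0 b (by simpa using hb), by simp⟩
  · simp

set_option linter.unusedSectionVars false

/-! ### Additive characters and inversion of multiplicative convolutions -/

section basics

variable {K : Type*} [Field K] [Algebra (ZMod 2) K]

lemma traceChar_apply (x : K) : traceChar K x = (-1) ^ (Algebra.trace (ZMod 2) K x).val := rfl

include K in
lemma charP_two_of_algebra : CharP K 2 := by
  rw [← Algebra.charP_iff (ZMod 2) K 2]; exact ZMod.charP 2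

variable [Fintype K]

lemma traceChar_pow_two (x : K) : traceChar K (x ^ 2) = traceChar K x := by
  have h := Algebra.trace_eq_of_algEquiv
    (FiniteField.frobeniusAlgEquivOfAlgebraic (ZMod 2) K) x
  rw [FiniteField.coe_frobeniusAlgEquivOfAlgebraic] at h
  simp only [ZMod.card] at h
  rw [traceChar_apply, traceChar_apply, h]

lemma traceChar_pow_two_pow (x : K) (n : ℕ) : traceChar K (x ^ 2 ^ n) = traceChar K x := by
  induction n with
  | zero => simp
  | succ n ih => rw [pow_succ, pow_mul, traceChar_pow_two, ih]

lemma traceChar_isPrimitive : (traceChar K).IsPrimitive := by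
  apply AddChar.IsPrimitive.of_ne_one
  rw [AddChar.ne_one_iff]
  obtain ⟨x, hx⟩ := Algebra.trace_surjective (ZMod 2) K 1
  exact ⟨x, by rw [traceChar_apply, hx]; decide⟩

variable [DecidableEq K]

lemma sum_traceChar_mul (a : K) :
    ∑ x : K, traceChar K (x * a) = if a = 0 then (Fintype.card K : ℤ) else 0 := by
  rw [AddChar.sum_mulShift a traceChar_isPrimitive]
  split_ifs <;> simp

lemma sum_units_traceChar_mul (a : K) :
    ∑ x : Kˣ, traceChar K (x * a) = (if a = 0 then (Fintype.card K : ℤ) else 0) - 1 := by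
  have := sum_eq_add_sum_units (fun x : K ↦ traceChar K (x * a))
  rw [sum_traceChar_mul] at this
  simp only [zero_mul, AddChar.map_zero_eq_one] at this
  linarith

lemma sum_units_traceChar : ∑ x : Kˣ, traceChar K x = -1 := by
  simpa using sum_units_traceChar_mul (1 : K)

/-- A function on the units is determined by its additive Fourier transform. -/
lemma eq_zero_of_forall_sum_traceChar_eq_zero (D : Kˣ → ℤ)
    (h : ∀ a : K, ∑ c : Kˣ, D c * traceChar K (a * c) = 0) (c : Kˣ) : D c = 0 := by
  -- Fourier inversion: multiply by χ(-ac) and sum over all a.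
  have h1 : ∑ a : K, (∑ b : Kˣ, D b * traceChar K (a * b)) * traceChar K (-(a * c)) = 0 := by
    simp [h]
  have h2 : ∀ a : K, (∑ b : Kˣ, D b * traceChar K (a * b)) * traceChar K (-(a * c)) =
      ∑ b : Kˣ, D b * traceChar K (a * (b - c)) := fun a ↦ by
    rw [Finset.sum_mul]
    refine Finset.sum_congr rfl fun b _ ↦ ?_
    rw [mul_assoc, ← AddChar.map_add_eq_mul]
    ring_nf
  simp_rw [h2] at h1
  rw [Finset.sum_comm] at h1
  simp_rw [← Finset.mul_sum, sum_traceChar_mul, sub_eq_zero, Units.val_inj] at h1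
  simpa using h1

/-- Twisting a multiplicative convolution with the character `χ ∘ σ` by `χ ∘ σ` recovers the
function up to a constant. -/
lemma sum_traceChar_mul_sum (σ : Kˣ →* Kˣ) (hσ : Function.Bijective σ) (D : Kˣ → ℤ) (a : Kˣ) :
    ∑ y : Kˣ, traceChar K (σ y) * ∑ z : Kˣ, D (a * y * z⁻¹) * traceChar K (σ z) =
      Fintype.card K * D a - ∑ z, D z := by
  have hK : CharP K 2 := charP_two_of_algebra
  have h1 : ∀ y : Kˣ, ∑ z : Kˣ, D (a * y * z⁻¹) * traceChar K (σ z) =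
      ∑ r : Kˣ, D (a * r⁻¹) * traceChar K (σ y * σ r) := fun y ↦ by
    -- Substitute z = y r, so that y survives only inside the characters.
    rw [← Equiv.sum_comp (Equiv.mulLeft y)]
    refine Finset.sum_congr rfl fun r _ ↦ ?_
    simp only [Equiv.coe_mulLeft, map_mul, Units.val_mul]
    rw [show a * y * (y * r)⁻¹ = a * r⁻¹ by rw [← div_eq_mul_inv, mul_comm y, mul_div_mul_right_eq_div, div_eq_mul_inv]]
  simp_rw [h1, Finset.mul_sum]
  rw [Finset.sum_comm]
  have h2 : ∀ r : Kˣ, ∑ y : Kˣ,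
      traceChar K (σ y) * (D (a * r⁻¹) * traceChar K (σ y * σ r)) =
      (if r = 1 then Fintype.card K * D a else 0) - D (a * r⁻¹) := fun r ↦ by
    have h3 : ∀ y : Kˣ, traceChar K (σ y) * (D (a * r⁻¹) * traceChar K (σ y * σ r)) =
        D (a * r⁻¹) * traceChar K (σ y * (1 + σ r)) := fun y ↦ by
      rw [mul_add, mul_one, AddChar.map_add_eq_mul]; ring
    simp_rw [h3]
    rw [← Finset.mul_sum, hσ.sum_comp (fun y : Kˣ ↦ traceChar K (y * (1 + σ r))), sum_units_traceChar_mul]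
    -- In characteristic two the combined character is trivial only at r = 1; this isolates D a.
    have h4 : (1 + (σ r : K) = 0) ↔ r = 1 := by
      rw [CharTwo.add_eq_zero, eq_comm, Units.val_eq_one, map_eq_one_iff σ hσ.1]
    simp only [h4]
    split_ifs with hr
    · subst hr; simp; ring
    · ring
  simp_rw [h2]
  rw [Finset.sum_sub_distrib]
  congr 1
  · simp
  · exact Equiv.sum_comp ((Equiv.inv Kˣ).trans (Equiv.mulLeft a)) D

end basics

/-- The Kloosterman sum `∑ y, χ (y) χ (c / y)` over the units of a field. -/
noncomputable def kloostermanSum {K : Type*} [Field K] [Algebra (ZMod 2) K] [Fintype Kˣ]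
    (c : Kˣ) : ℤ :=
  ∑ y : Kˣ, traceChar K y * traceChar K (c * y⁻¹ : Kˣ)

/-! ### Norm fibres of a quadratic extension and the Hadamard transform -/

section quadratic

variable {K L : Type*} [Field K] [Field L] [Algebra (ZMod 2) K] [Algebra (ZMod 2) L]
  [Algebra K L] [Fintype K] [Fintype L] [DecidableEq K] [DecidableEq L]

/-- The sum of the canonical additive character of `L` over the elements of norm `z`. -/
noncomputable def normFiberSum (L : Type*) [Field L] [Algebra (ZMod 2) L] [Algebra K L]
    [Fintype L] [DecidableEq L] (z : Kˣ) : ℤ :=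
  ∑ u : Lˣ with Units.map (Algebra.norm K) u = z, traceChar L u

lemma sum_normFiberSum_mul (f : Kˣ → ℤ) :
    ∑ z : Kˣ, normFiberSum L z * f z =
      ∑ u : Lˣ, traceChar L u * f (Units.map (Algebra.norm K) u) := by
  rw [← Finset.sum_fiberwise (s := Finset.univ) (g := Units.map (Algebra.norm K (S := L)))]
  refine Finset.sum_congr rfl fun z _ ↦ ?_
  rw [normFiberSum, Finset.sum_mul]
  refine Finset.sum_congr rfl fun u hu ↦ ?_
  rw [(Finset.mem_filter.1 hu).2]

lemma sum_normFiberSum : ∑ z : Kˣ, normFiberSum L z = -1 := by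
  have := sum_normFiberSum_mul (L := L) (fun _ : Kˣ ↦ 1)
  simpa [sum_units_traceChar] using this

lemma traceChar_eq_traceChar_trace (x : L) :
    traceChar L x = traceChar K (Algebra.trace K L x) := by
  have : IsScalarTower (ZMod 2) K L := IsScalarTower.of_algebraMap_eq' (Subsingleton.elim _ _)
  rw [traceChar_apply, traceChar_apply, Algebra.trace_trace]

variable (hKL : Module.finrank K L = 2)
include hKL

lemma card_eq_sq_of_finrank_eq_two : Fintype.card L = Fintype.card K ^ 2 := by
  rw [Module.card_eq_pow_finrank (K := K), hKL]

lemma algebraMap_norm_of_finrank_eq_two (x : L) :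
    algebraMap K L (Algebra.norm K x) = x ^ (Fintype.card K + 1) := by
  rw [FiniteField.algebraMap_norm_eq_pow_sum, hKL]
  simp [Finset.sum_range_succ, add_comm]

lemma algebraMap_trace_of_finrank_eq_two (x : L) :
    algebraMap K L (Algebra.trace K L x) = x ^ Fintype.card K + x := by
  rw [FiniteField.algebraMap_trace_eq_sum_pow, hKL]
  simp [Finset.sum_range_succ, add_comm]

/-- This serves to complete the square: a shift by an element of K absorbs the trace into the norm.
-/
lemma norm_add_algebraMap (x : L) (b : K) :
    Algebra.norm K (x + algebraMap K L b) =
      Algebra.norm K x + b * Algebra.trace K L x + b ^ 2 := by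
  have h2 : CharP K 2 := charP_two_of_algebra
  have hp : ∃ n : ℕ, Fintype.card K = 2 ^ n := by
    obtain ⟨n, _, hn⟩ := FiniteField.card K 2
    exact ⟨n, hn⟩
  have h2' : CharP L 2 := charP_two_of_algebra
  apply (algebraMap K L).injective
  have hb : algebraMap K L b ^ Fintype.card K = algebraMap K L b := by
    rw [← map_pow, FiniteField.pow_card]
  have hadd : (x + algebraMap K L b) ^ Fintype.card K
      = x ^ Fintype.card K + algebraMap K L b := by
    obtain ⟨n, hn⟩ := hp
    rw [hn, add_pow_char_pow, ← hn, hb]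
  rw [map_add (algebraMap K L), map_add (algebraMap K L), map_mul (algebraMap K L),
    map_pow (algebraMap K L), algebraMap_norm_of_finrank_eq_two hKL,
    algebraMap_norm_of_finrank_eq_two hKL, algebraMap_trace_of_finrank_eq_two hKL,
    pow_succ, hadd]
  ring

/-- The norm is onto Kˣ with fibres of size q + 1, so the sum is 1 + (q + 1)(-1), the 1 coming from
u = 0. -/
lemma sum_traceChar_mul_norm {a : K} (ha : a ≠ 0) :
    ∑ u : L, traceChar K (Algebra.norm K u * a) = -Fintype.card K := by
  have hfib : ∀ z : Kˣ, ((Finset.univ : Finset Lˣ).filter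
      (fun u ↦ Units.map (Algebra.norm K) u = z)).card = Fintype.card K + 1 := by
    have hsurj := FiniteField.unitsMap_norm_surjective K L
    have hc : ∀ z : Kˣ, ((Finset.univ : Finset Lˣ).filter
        (fun u ↦ Units.map (Algebra.norm K) u = z)).card = ((Finset.univ : Finset Lˣ).filter
        (fun u ↦ Units.map (Algebra.norm K) u = 1)).card := fun z ↦
      MonoidHom.card_fiber_eq_of_mem_range _ (hsurj z) (hsurj 1)
    have htot := Finset.card_eq_sum_card_fiberwise (s := (Finset.univ : Finset Lˣ))
      (t := (Finset.univ : Finset Kˣ)) (f := Units.map (Algebra.norm K (S := L))) (by simp)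
    simp_rw [hc] at htot
    rw [Finset.sum_const, Finset.card_univ, Finset.card_univ, Fintype.card_units,
      Fintype.card_units, card_eq_sq_of_finrank_eq_two hKL, smul_eq_mul,
      show Fintype.card K ^ 2 - 1 = (Fintype.card K - 1) * (Fintype.card K + 1) by
        rw [mul_comm]; simpa using Nat.sq_sub_sq (Fintype.card K) 1] at htot
    have hq : 0 < Fintype.card K - 1 := Nat.sub_pos_of_lt Fintype.one_lt_card
    intro z
    rw [hc]
    exact (Nat.eq_of_mul_eq_mul_left hq htot).symm
  rw [sum_eq_add_sum_units, ← Finset.sum_fiberwise (s := Finset.univ)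
    (g := Units.map (Algebra.norm K (S := L)))]
  have h : ∀ z : Kˣ, ∑ u : Lˣ with Units.map (Algebra.norm K) u = z,
      traceChar K (Algebra.norm K (u : L) * a) = (Fintype.card K + 1) * traceChar K (z * a) :=
    fun z ↦ by
    rw [Finset.sum_congr rfl (g := fun _ ↦ traceChar K (z * a)), Finset.sum_const, hfib]
    · simp
    · intro u hu
      rw [← (Finset.mem_filter.1 hu).2]
      rfl
  simp_rw [h]
  rw [← Finset.mul_sum, sum_units_traceChar_mul, if_neg ha]
  simp

/-- The sum of the additive character over a norm fibre is minus a Kloosterman sum. -/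
lemma normFiberSum_eq_neg_kloostermanSum (z : Kˣ) :
    normFiberSum L z = -kloostermanSum z := by
  have h2 : CharP K 2 := charP_two_of_algebra
  rw [← add_eq_zero_iff_eq_neg]
  -- It suffices that the additive Fourier transforms of the two functions cancel at every a.
  refine eq_zero_of_forall_sum_traceChar_eq_zero
    (fun z ↦ normFiberSum L z + kloostermanSum z) (fun a ↦ ?_) z
  simp_rw [add_mul]
  rw [Finset.sum_add_distrib, sum_normFiberSum_mul (fun z : Kˣ ↦ traceChar K (a * z))]
  have hkl : ∑ c : Kˣ, kloostermanSum c * traceChar K (a * c) =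
      ∑ y : Kˣ, traceChar K y * ∑ c : Kˣ, traceChar K (c * (y⁻¹ + a)) := by
    simp_rw [kloostermanSum, Finset.sum_mul]
    rw [Finset.sum_comm]
    refine Finset.sum_congr rfl fun y _ ↦ ?_
    rw [Finset.mul_sum]
    refine Finset.sum_congr rfl fun c _ ↦ ?_
    rw [mul_add, AddChar.map_add_eq_mul, mul_assoc, mul_comm (c : K) a]
    simp
  rw [hkl]
  simp_rw [sum_units_traceChar_mul, mul_sub, mul_one]
  rw [Finset.sum_sub_distrib, sum_units_traceChar]
  rcases eq_or_ne a 0 with rfl | ha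
  · simp [sum_units_traceChar]
  · have h3 : ∀ y : Kˣ, (((y⁻¹ : Kˣ) : K) + a = 0) ↔ y = (Units.mk0 a ha)⁻¹ := fun y ↦ by
      rw [CharTwo.add_eq_zero]
      conv_lhs => rw [← Units.val_mk0 ha, Units.val_inj, inv_eq_iff_eq_inv]
    simp_rw [h3]
    -- Completing the square: a N(u + 1/a) = a N(u) + Tr u + 1/a.
    have h4 : ∀ u : L, traceChar L u * traceChar K (a * Algebra.norm K u) =
        traceChar K (Algebra.norm K (u + algebraMap K L a⁻¹) * a) * traceChar K a⁻¹ := fun u ↦ by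
      rw [traceChar_eq_traceChar_trace (K := K), norm_add_algebraMap hKL,
        ← AddChar.map_add_eq_mul, ← AddChar.map_add_eq_mul]
      congr 1
      have : (a⁻¹ * Algebra.trace K L u) * a = Algebra.trace K L u := by field_simp
      have h5 : a⁻¹ ^ 2 * a = a⁻¹ := by field_simp
      rw [add_mul, add_mul, this, h5, add_assoc, CharTwo.add_self_eq_zero]
      ring
    have h5 := sum_eq_add_sum_units
      (fun u : L ↦ traceChar L u * traceChar K (a * Algebra.norm K u))
    simp_rw [h4] at h5
    have h7 : ∑ u : L, traceChar K (Algebra.norm K (u + algebraMap K L a⁻¹) * a) =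
        -Fintype.card K := by
      rw [← sum_traceChar_mul_norm hKL ha]
      exact Equiv.sum_comp (Equiv.addRight (algebraMap K L a⁻¹))
        (fun u ↦ traceChar K (Algebra.norm K u * a))
    rw [← Finset.sum_mul, h7, ← h4] at h5
    simp only [mul_zero, AddChar.map_zero_eq_one, Algebra.norm_zero, one_mul] at h5
    have h6 : ∀ u : Lˣ, traceChar L (u : L) *
        traceChar K (a * (Units.map (Algebra.norm K) u : Kˣ)) =
        traceChar K (Algebra.norm K ((u : L) + algebraMap K L a⁻¹) * a) * traceChar K a⁻¹ :=
      fun u ↦ h4 u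
    simp_rw [h6]
    simp only [mul_ite, mul_zero, Finset.sum_ite_eq', Finset.mem_univ, if_true,
      Units.val_inv_eq_inv_val, Units.val_mk0]
    linarith

/-- The power of x is N(x)^s, which lies in K, so transitivity of the trace replaces α by its
relative trace. The substitution x = u/l and grouping by norm do the rest; the leading 1 is the term
x = 0. -/
lemma hadamardTransform_unit (α : L) (s : ℕ) (hs : s ≠ 0) (l : Lˣ) :
    hadamardTransform
      (fun x : L ↦ Algebra.trace (ZMod 2) L (α * x ^ ((Fintype.card K + 1) * s))) l =
      1 + ∑ z : Kˣ, normFiberSum L z * traceChar K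
        (Algebra.trace K L α * ((z * (Units.map (Algebra.norm K) (l : Lˣ))⁻¹) ^ s : Kˣ)) := by
  have h1 : ∀ x : L, (-1 : ℤ) ^ (Algebra.trace (ZMod 2) L
      (α * x ^ ((Fintype.card K + 1) * s)) + Algebra.trace (ZMod 2) L (l * x)).val =
      traceChar L (l * x) * traceChar K (Algebra.trace K L α * Algebra.norm K x ^ s) := fun x ↦ by
    rw [← map_add, ← traceChar_apply, add_comm, AddChar.map_add_eq_mul]
    congr 1
    rw [traceChar_eq_traceChar_trace (K := K), pow_mul,
      ← algebraMap_norm_of_finrank_eq_two hKL, ← map_pow, mul_comm α, ← Algebra.smul_def,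
      map_smul, smul_eq_mul, mul_comm]
  rw [hadamardTransform]
  simp_rw [h1]
  rw [sum_eq_add_sum_units, sum_normFiberSum_mul (fun z : Kˣ ↦ traceChar K
    (Algebra.trace K L α * ((z * (Units.map (Algebra.norm K) (l : Lˣ))⁻¹) ^ s : Kˣ))),
    ← Equiv.sum_comp (Equiv.mulLeft l⁻¹)]
  congr 1
  · simp [hs]
  · refine Finset.sum_congr rfl fun u _ ↦ ?_
    have h2 : (l : L) * (l⁻¹ * u : Lˣ) = u := by simp
    have h3 : Algebra.norm K ((l⁻¹ * u : Lˣ) : L) =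
        ((Units.map (Algebra.norm K) u * (Units.map (Algebra.norm K) l)⁻¹ : Kˣ) : K) := by
      rw [← map_inv, mul_comm, ← map_mul]
      rfl
    rw [Equiv.coe_mulLeft, h2, h3, Units.val_pow_eq_pow_val]

/-- If `x ↦ Tr (α x ^ ((q + 1) s))` is bent on `L`, then the signs of its Hadamard transform
deconvolve the Kloosterman sums of `K` with respect to `y ↦ χ (y ^ s)`. -/
lemma exists_sign_of_bent (α : L) (s : ℕ) (hs : s ≠ 0)
    (hbij : Function.Bijective (powMonoidHom s : Kˣ →* Kˣ))
    (hbent : ∀ l : L, hadamardTransform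
      (fun x : L ↦ Algebra.trace (ZMod 2) L (α * x ^ ((Fintype.card K + 1) * s))) l =
        Fintype.card K ∨ hadamardTransform
      (fun x : L ↦ Algebra.trace (ZMod 2) L (α * x ^ ((Fintype.card K + 1) * s))) l =
        -Fintype.card K) :
    ∃ ε : Kˣ → ℤ, (∀ c, ε c = 1 ∨ ε c = -1) ∧ ∀ c : Kˣ,
      ∑ y : Kˣ, ε (c * y⁻¹) * traceChar K (y ^ s : Kˣ) = kloostermanSum c := by
  have hq : (Fintype.card K : ℤ) ≠ 0 := by exact_mod_cast Fintype.card_ne_zero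
  -- Otherwise the transform at 1 would be 1 + (-1) = 0.
  have hA : Algebra.trace K L α ≠ 0 := fun hA ↦ by
    have h1 := hadamardTransform_unit hKL α s hs 1
    simp only [hA, zero_mul, AddChar.map_zero_eq_one, mul_one, sum_normFiberSum] at h1
    have := hbent (1 : Lˣ)
    rw [h1] at this
    omega
  obtain ⟨a, ha⟩ := hbij.2 (Units.mk0 _ hA)
  have hV : ∀ c : Kˣ, ∃ e : ℤ, (e = 1 ∨ e = -1) ∧
      1 + ∑ z : Kˣ, normFiberSum L z * traceChar K ((c⁻¹ * z) ^ s : Kˣ) =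
        -(Fintype.card K * e) := fun c ↦ by
    -- Since a^s is the relative trace of α, choosing N(l) = a c cancels that coefficient.
    obtain ⟨l, hl⟩ := FiniteField.unitsMap_norm_surjective K L (a * c)
    have h1 := hadamardTransform_unit hKL α s hs l
    have h2 : ∀ z : Kˣ, Algebra.trace K L α *
        ((z * (Units.map (Algebra.norm K) (l : Lˣ))⁻¹) ^ s : Kˣ) =
        ((c⁻¹ * z) ^ s : Kˣ) := fun z ↦ by
      rw [hl, ← Units.val_mk0 hA, ← ha, powMonoidHom_apply, ← Units.val_mul, ← mul_pow,
        mul_inv, mul_left_comm, mul_inv_cancel_left, mul_comm]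
    simp_rw [h2] at h1
    rw [← h1]
    rcases hbent l with h | h
    · exact ⟨-1, by simp, by rw [h]; ring⟩
    · exact ⟨1, by simp, by rw [h]; ring⟩
  choose ε hε hεV using hV
  refine ⟨ε, hε, fun c ↦ ?_⟩
  -- Inverting z makes the correlation a convolution, to which the inversion formula applies at 1/c.
  have h1 := sum_traceChar_mul_sum (powMonoidHom s) hbij
    (fun z : Kˣ ↦ normFiberSum L z⁻¹) c⁻¹
  have h2 : ∀ y : Kˣ, ∑ z : Kˣ, normFiberSum L (c⁻¹ * y * z⁻¹)⁻¹ *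
      traceChar K (powMonoidHom s z : Kˣ) = -(Fintype.card K * ε (c * y⁻¹)) - 1 := fun y ↦ by
    rw [← hεV, ← Equiv.sum_comp (Equiv.mulLeft (c⁻¹ * y)), add_sub_cancel_left]
    refine Finset.sum_congr rfl fun z _ ↦ ?_
    have h3 : (c⁻¹ * y * (c⁻¹ * y * z)⁻¹)⁻¹ = z := by
      rw [mul_inv, inv_inv, inv_mul_cancel_left]
    have h4 : (c * y⁻¹)⁻¹ = c⁻¹ * y := by rw [mul_inv, inv_inv]
    rw [Equiv.coe_mulLeft, h3, h4, powMonoidHom_apply]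
  simp_rw [h2, mul_sub] at h1
  have h5 : ∑ z : Kˣ, normFiberSum L z⁻¹ = -1 := by
    rw [← sum_normFiberSum (K := K) (L := L)]
    exact Equiv.sum_comp (Equiv.inv Kˣ) (normFiberSum L)
  rw [Finset.sum_sub_distrib, inv_inv, h5, normFiberSum_eq_neg_kloostermanSum hKL] at h1
  have h3 : ∑ y : Kˣ, traceChar K (powMonoidHom s y : Kˣ) * 1 = -1 := by
    simp_rw [mul_one]
    rw [hbij.sum_comp (fun y : Kˣ ↦ traceChar K y), sum_units_traceChar]
  rw [h3] at h1
  apply mul_left_cancel₀ hq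
  rw [Finset.mul_sum]
  have h4 : ∑ y : Kˣ, traceChar K (powMonoidHom s y : Kˣ) *
      -(Fintype.card K * ε (c * y⁻¹)) = -∑ y : Kˣ, (Fintype.card K : ℤ) *
        (ε (c * y⁻¹) * traceChar K (y ^ s : Kˣ)) := by
    rw [← Finset.sum_neg_distrib]
    refine Finset.sum_congr rfl fun y _ ↦ ?_
    rw [powMonoidHom_apply]
    ring
  rw [h4] at h1
  linarith

end quadratic

/-! ### Gauss sums in the Witt vectors modulo eight -/

noncomputable section teichmuller

open WittVector

variable {K : Type*} [Field K] [Algebra (ZMod 2) K] [Fintype K] [DecidableEq K] [CharP K 2]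

/-- The Teichmüller character on the units of a field of characteristic two. -/
def teichmullerUnits (K : Type*) [Field K] : Kˣ →* WittVector 2 K :=
  (teichmuller 2).comp (Units.coeHom K)

lemma constantCoeff_teichmullerUnits (x : Kˣ) :
    constantCoeff (teichmullerUnits K x) = (x : K) :=
  teichmuller_coeff_zero 2 _

lemma teichmullerUnits_injective : Function.Injective (teichmullerUnits K) := fun x y h ↦ by
  apply Units.ext
  rw [← constantCoeff_teichmullerUnits, h, constantCoeff_teichmullerUnits]

lemma two_dvd_of_constantCoeff_eq_zero (x : WittVector 2 K) (h : constantCoeff x = 0) :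
    2 ∣ x := by
  have := (mem_span_p_iff_coeff_zero_eq_zero (p := 2) x).2 h
  simpa [Ideal.mem_span_singleton] using this

lemma constantCoeff_two : constantCoeff (2 : WittVector 2 K) = 0 := by
  rw [map_ofNat]; exact CharTwo.two_eq_zero

lemma two_ne_zero_wittVector : (2 : WittVector 2 K) ≠ 0 := by
  have := WittVector.p_nonzero 2 K
  simpa using this

/-- The Teichmüller lift of the trace. -/
def teichmullerTrace (x : Kˣ) : WittVector 2 K :=
  ∑ i ∈ Finset.range (Module.finrank (ZMod 2) K), teichmullerUnits K x ^ 2 ^ i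

/-- Modulo eight the canonical additive character is a quadratic polynomial in Teichmüller
representatives. -/
lemma traceChar_eq_teichmullerTrace (x : Kˣ) : ∃ r : WittVector 2 K,
    (traceChar K x : WittVector 2 K) =
      1 - 4 * teichmullerTrace x + 2 * teichmullerTrace x ^ 2 + 8 * r := by
  have h : constantCoeff (teichmullerTrace x) =
      algebraMap (ZMod 2) K (Algebra.trace (ZMod 2) K x) := by
    rw [FiniteField.algebraMap_trace_eq_sum_pow, teichmullerTrace, map_sum]
    simp only [map_pow, constantCoeff_teichmullerUnits, Nat.card_zmod]
  rw [traceChar_apply]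
  generalize Algebra.trace (ZMod 2) K x = b at h ⊢
  have hb : ∀ b : ZMod 2, b = 0 ∨ b = 1 := by decide
  obtain rfl | rfl := hb b
  -- The polynomial 1 - 4T + 2T^2 is 1 mod 8 at even T and -1 mod 8 at odd T.
  · obtain ⟨t, ht⟩ := two_dvd_of_constantCoeff_eq_zero _ (h.trans (map_zero _))
    rw [ht]
    exact ⟨t - t ^ 2, by simp; ring⟩
  · obtain ⟨t, ht⟩ := two_dvd_of_constantCoeff_eq_zero (teichmullerTrace x - 1)
      (by rw [map_sub, h]; simp)
    rw [sub_eq_iff_eq_add.1 ht]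
    refine ⟨- t ^ 2, ?_⟩
    rw [show (1 : ZMod 2).val = 1 from rfl]
    push_cast
    ring

lemma sum_teichmullerUnits_comp {f : Kˣ →* Kˣ} (hf : f ≠ 1) :
    ∑ y : Kˣ, teichmullerUnits K (f y) = 0 := by
  refine sum_hom_units_eq_zero ((teichmullerUnits K).comp f) fun h ↦ hf ?_
  ext1 y
  apply teichmullerUnits_injective
  simpa using DFunLike.congr_fun h y

/-- A Gauss sum is divisible by eight unless its exponent has binary weight at most two. -/
lemma eight_dvd_sum (s : ℕ) (hK : ∃ y : Kˣ, y ≠ 1)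
    (h : ∀ i j : ℕ, ∃ y : Kˣ, y ^ (s * (2 ^ i + 2 ^ j)) ≠ y) :
    8 ∣ ∑ y : Kˣ, (traceChar K (y ^ s : Kˣ) : WittVector 2 K) * teichmullerUnits K y⁻¹ := by
  have hmono : ∀ i j : ℕ, ∑ y : Kˣ, teichmullerUnits K (y ^ s) ^ (2 ^ i + 2 ^ j) *
      teichmullerUnits K y⁻¹ = 0 := fun i j ↦ by
    obtain ⟨y, hy⟩ := h i j
    have := sum_teichmullerUnits_comp
      (f := (powMonoidHom (s * (2 ^ i + 2 ^ j)) : Kˣ →* Kˣ) * invMonoidHom)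
      fun h ↦ hy (by simpa [mul_inv_eq_one] using DFunLike.congr_fun h y)
    simpa [pow_mul] using this
  have hinv : ∑ y : Kˣ, teichmullerUnits K y⁻¹ = 0 := by
    obtain ⟨y, hy⟩ := hK
    exact sum_teichmullerUnits_comp (f := (invMonoidHom : Kˣ →* Kˣ))
      fun h ↦ hy (by simpa using DFunLike.congr_fun h y)
  choose r hr using fun x : Kˣ ↦ traceChar_eq_teichmullerTrace (x ^ s)
  simp_rw [hr, add_mul, sub_mul, one_mul]
  rw [Finset.sum_add_distrib, Finset.sum_add_distrib, Finset.sum_sub_distrib, hinv]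
  have h1 : ∑ y : Kˣ, 4 * teichmullerTrace (y ^ s) * teichmullerUnits K y⁻¹ = 0 := by
    simp_rw [teichmullerTrace, Finset.mul_sum, Finset.sum_mul]
    rw [Finset.sum_comm]
    refine Finset.sum_eq_zero fun i _ ↦ ?_
    simp_rw [mul_assoc]
    rw [← Finset.mul_sum]
    cases i with
    | succ i => rw [pow_succ, mul_two, hmono, mul_zero]
    | zero =>
      -- The exponent 1 is also of the form 2^n + 2^n: x = x^q, and q = 2^(n+1).
      obtain ⟨n, hn⟩ := Nat.exists_eq_succ_of_ne_zero
        (Module.finrank_pos (R := ZMod 2) (M := K)).ne'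
      have h3 : ∀ x : Kˣ, teichmullerUnits K x ^ 2 ^ 0 =
          teichmullerUnits K x ^ (2 ^ n + 2 ^ n) := fun x ↦ by
        rw [← map_pow, ← map_pow, ← mul_two, ← pow_succ, ← Nat.succ_eq_add_one, ← hn,
          FiniteField.pow_finrank_eq_card 2 K]
        congr 1
        ext1
        simp [FiniteField.pow_card]
      simp_rw [h3]
      rw [hmono, mul_zero]
  have h2 : ∑ y : Kˣ, 2 * teichmullerTrace (y ^ s) ^ 2 * teichmullerUnits K y⁻¹ = 0 := by
    simp_rw [teichmullerTrace, sq, Finset.sum_mul_sum, ← pow_add, Finset.mul_sum, Finset.sum_mul]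
    rw [Finset.sum_comm]
    refine Finset.sum_eq_zero fun i _ ↦ ?_
    rw [Finset.sum_comm]
    refine Finset.sum_eq_zero fun j _ ↦ ?_
    simp_rw [mul_assoc]
    rw [← Finset.mul_sum, hmono, mul_zero]
  rw [h1, h2]
  simp_rw [mul_assoc]
  rw [← Finset.mul_sum]
  simp

/-- The square of the Gauss sum of the inverse Teichmüller character is not divisible by eight. -/
lemma not_eight_dvd_sum_sq (hK : ∃ y : Kˣ, y ≠ 1) (r : WittVector 2 K) :
    (∑ y : Kˣ, (traceChar K y : WittVector 2 K) * teichmullerUnits K y⁻¹) ^ 2 ≠ 8 * r := by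
  have hinv : ∑ y : Kˣ, teichmullerUnits K y⁻¹ = 0 := by
    obtain ⟨y, hy⟩ := hK
    exact sum_teichmullerUnits_comp (f := (invMonoidHom : Kˣ →* Kˣ))
      fun h ↦ hy (by simpa using DFunLike.congr_fun h y)
  have hχ : ∀ y : Kˣ, (traceChar K y : WittVector 2 K) =
      1 - 2 * ((Algebra.trace (ZMod 2) K y).val : WittVector 2 K) := fun y ↦ by
    rw [traceChar_apply]
    generalize Algebra.trace (ZMod 2) K y = b
    have hb : ∀ b : ZMod 2, b = 0 ∨ b = 1 := by decide
    obtain rfl | rfl := hb b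
    · simp
    · rw [show (1 : ZMod 2).val = 1 from rfl]
      push_cast
      ring
  simp_rw [hχ, sub_mul, one_mul, mul_assoc]
  rw [Finset.sum_sub_distrib, hinv, ← Finset.mul_sum]
  -- The Gauss sum is -2g. Modulo 2, g is a sum of the power sums of y^(2^i - 1), of which only i =
  -- 0 survives, so g is odd.
  set g := ∑ y : Kˣ, ((Algebra.trace (ZMod 2) K y).val : WittVector 2 K) *
    teichmullerUnits K y⁻¹ with hg
  have hg1 : constantCoeff g = 1 := by
    have h1 : ∀ y : Kˣ, constantCoeff (((Algebra.trace (ZMod 2) K y).val : WittVector 2 K) *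
        teichmullerUnits K y⁻¹) = ∑ i ∈ Finset.range (Module.finrank (ZMod 2) K),
          (y : K) ^ (2 ^ i - 1) := fun y ↦ by
      rw [map_mul, constantCoeff_teichmullerUnits, map_natCast,
        show (((Algebra.trace (ZMod 2) K y).val : ℕ) : K) =
          algebraMap (ZMod 2) K (Algebra.trace (ZMod 2) K y) by
          rw [← map_natCast (algebraMap (ZMod 2) K), ZMod.natCast_zmod_val],
        FiniteField.algebraMap_trace_eq_sum_pow, Finset.sum_mul, Nat.card_zmod]
      refine Finset.sum_congr rfl fun i _ ↦ ?_
      rw [Units.val_inv_eq_inv_val, mul_inv_eq_iff_eq_mul₀ y.ne_zero, ← pow_succ,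
        Nat.sub_add_cancel Nat.one_le_two_pow]
    rw [hg, map_sum]
    simp_rw [h1]
    rw [Finset.sum_comm, Finset.sum_eq_single 0]
    · rw [FiniteField.sum_pow_units]
      simp [CharTwo.neg_eq]
    · intro i hi hi0
      rw [FiniteField.sum_pow_units, if_neg]
      rw [← FiniteField.pow_finrank_eq_card 2 K]
      have h2 : 2 ^ i < 2 ^ Module.finrank (ZMod 2) K :=
        Nat.pow_lt_pow_right one_lt_two (Finset.mem_range.1 hi)
      have h3 : 1 < 2 ^ i := Nat.one_lt_two_pow hi0
      exact Nat.not_dvd_of_pos_of_lt (by omega) (by omega)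
    · intro h
      exact absurd (Finset.mem_range.2 Module.finrank_pos) h
  intro h
  have h4 : g ^ 2 = 2 * r := by
    have h5 : (2 : WittVector 2 K) ^ 2 ≠ 0 := pow_ne_zero 2 two_ne_zero_wittVector
    apply mul_left_cancel₀ h5
    linear_combination h
  have h6 := congrArg constantCoeff h4
  rw [map_mul, constantCoeff_two, zero_mul, map_pow, hg1] at h6
  simp at h6

end teichmuller

/-! ### Fibres of x (1 + x)^(2^m) and Kloosterman sums -/

section fibers

variable {K : Type*} [Field K] [Algebra (ZMod 2) K] [Fintype K] [DecidableEq K]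

/-- The number of solutions of `x (1 + x) ^ 2 ^ m = c`. -/
def fiberCard (m : ℕ) (c : K) : ℕ :=
  (Finset.univ.filter fun x : K ↦ x * (1 + x) ^ 2 ^ m = c).card

/-- The 2 accounts for x = 0 and x = 1, the points over 0. -/
lemma sum_fiberCard (m : ℕ) : ∑ c : Kˣ, fiberCard m (c : K) + 2 = Fintype.card K := by
  have hK : CharP K 2 := charP_two_of_algebra
  have h := Finset.card_eq_sum_card_fiberwise (s := (Finset.univ : Finset K))
    (t := (Finset.univ : Finset K)) (f := fun x : K ↦ x * (1 + x) ^ 2 ^ m) (by simp)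
  rw [sum_eq_add_sum_units, Finset.card_univ] at h
  have h0 : (Finset.univ.filter fun x : K ↦ x * (1 + x) ^ 2 ^ m = 0) = {0, 1} := by
    ext x
    simp [CharTwo.add_eq_zero, eq_comm (a := x)]
  rw [h, h0, Finset.card_pair zero_ne_one, add_comm]
  rfl

lemma units_pow_two_pow_bijective (m : ℕ) :
    Function.Bijective (powMonoidHom (2 ^ m) : Kˣ →* Kˣ) := by
  have hK : CharP K 2 := charP_two_of_algebra
  refine Finite.injective_iff_bijective.1 fun x y h ↦ Units.ext ?_
  apply iterateFrobenius_inj K 2 m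
  simpa [iterateFrobenius_def] using congrArg Units.val h

/-- Substitute y = b^(2^m) and use that χ is Frobenius invariant. -/
lemma kloostermanSum_eq_sum_add (m : ℕ) (c : Kˣ) :
    kloostermanSum c = ∑ b : Kˣ, traceChar K (b + (c * (b ^ 2 ^ m)⁻¹ : Kˣ)) := by
  rw [kloostermanSum, ← (units_pow_two_pow_bijective m).sum_comp]
  refine Finset.sum_congr rfl fun b _ ↦ ?_
  rw [AddChar.map_add_eq_mul, powMonoidHom_apply, Units.val_pow_eq_pow_val,
    traceChar_pow_two_pow]

/-- A Kloosterman sum is a multiplicative convolution of the fibre counts. -/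
lemma kloostermanSum_eq_sum_fiberCard (m : ℕ) (σ : Kˣ →* Kˣ)
    (hσ : ∀ y, σ y * σ y ^ 2 ^ m = y) (c : Kˣ) :
    kloostermanSum c =
      1 + ∑ y : Kˣ, (fiberCard m ((c * y⁻¹ : Kˣ) : K) : ℤ) * traceChar K (σ y) := by
  have hK : CharP K 2 := charP_two_of_algebra
  have hinj : ∀ x y : Kˣ, x * x ^ 2 ^ m = y * y ^ 2 ^ m → x = y := by
    have hsurj : Function.Surjective (fun x : Kˣ ↦ x * x ^ 2 ^ m) := fun y ↦ ⟨σ y, hσ y⟩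
    exact fun x y h ↦ (Finite.injective_iff_surjective.2 hsurj) h
  -- The term b = σ c is the one where b + c/b^(2^m) vanishes; it gives the 1.
  rw [kloostermanSum_eq_sum_add m, ← Finset.add_sum_erase _ _ (Finset.mem_univ (σ c))]
  congr 1
  · have : c * (σ c ^ 2 ^ m)⁻¹ = σ c := by
      rw [mul_inv_eq_iff_eq_mul, hσ]
    rw [this, CharTwo.add_self_eq_zero, AddChar.map_zero_eq_one]
  · have h1 : ∀ y : Kˣ, (fiberCard m ((c * y⁻¹ : Kˣ) : K) : ℤ) * traceChar K (σ y) =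
        ∑ x : K with x * (1 + x) ^ 2 ^ m = ((c * y⁻¹ : Kˣ) : K), traceChar K (σ y) := fun y ↦ by
      rw [Finset.sum_const, fiberCard, nsmul_eq_mul]
    simp_rw [h1]
    rw [Finset.sum_sigma']
    have hne : ∀ (y : Kˣ) (x : K), x * (1 + x) ^ 2 ^ m = ((c * y⁻¹ : Kˣ) : K) → 1 + x ≠ 0 := by
      intro y x h hx
      rw [hx, zero_pow (by simp), mul_zero] at h
      exact (Units.ne_zero _ h.symm)
    have hkey : ∀ (y : Kˣ) (x : K), x * (1 + x) ^ 2 ^ m = ((c * y⁻¹ : Kˣ) : K) → ∀ b : Kˣ,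
        (b : K) = σ y * (1 + x) → ((c * (b ^ 2 ^ m)⁻¹ : Kˣ) : K) = σ y * x := by
      intro y x h b hb
      have h2 : (c : K) = x * (1 + x) ^ 2 ^ m * y := by rw [h]; simp
      have h3 : (y : K) = σ y * σ y ^ 2 ^ m := by
        conv_lhs => rw [← hσ y]
        simp
      have h4 := hne y x h
      have h5 := (σ y).ne_zero
      rw [Units.val_mul, Units.val_inv_eq_inv_val, Units.val_pow_eq_pow_val, hb, h2,
        mul_inv_eq_iff_eq_mul₀ (pow_ne_zero _ (mul_ne_zero h5 h4)), mul_pow]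
      conv_lhs => rw [h3]
      ring
    symm
    -- Parametrise b = w (1 + x) with w = σ y. Then c/b^(2^m) = w x, the two add up to w, and c = y
    -- x (1 + x)^(2^m).
    refine Finset.sum_bij (fun p hp ↦ σ p.1 * Units.mk0 (1 + p.2)
      (hne p.1 p.2 (by simpa using hp))) ?_ ?_ ?_ ?_
    · rintro ⟨y, x⟩ hp
      simp only [Finset.mem_sigma, Finset.mem_univ, true_and, Finset.mem_filter] at hp
      simp only [Finset.mem_erase, Finset.mem_univ, and_true]
      intro hb
      have h2 := hkey y x hp _ (congrArg Units.val hb.symm)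
      rw [mul_inv_eq_iff_eq_mul.2 (hσ c).symm, ← hb] at h2
      simp only [Units.val_mul, Units.val_mk0, mul_eq_mul_left_iff, Units.ne_zero, or_false] at h2
      simp at h2
    · rintro ⟨y, x⟩ hp ⟨y', x'⟩ hp' h
      simp only [Finset.mem_sigma, Finset.mem_univ, true_and, Finset.mem_filter] at hp hp'
      have h2 := hkey y x hp (σ y * Units.mk0 (1 + x) (hne y x hp)) rfl
      have h3 := hkey y' x' hp' _ (congrArg Units.val h)
      have h4 := congrArg Units.val h
      simp only [Units.val_mul, Units.val_mk0] at h4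
      have h5 : (σ y : K) * x = σ y' * x' := h2.symm.trans h3
      have h6 : σ y = σ y' := Units.ext (by linear_combination h4 - h5)
      have h7 : y = y' := by rw [← hσ y, h6, hσ]
      subst h7
      have h8 : x = x' := by simpa using h5
      rw [h8]
    · intro b hb
      have hb' : b ≠ σ c := Finset.ne_of_mem_erase hb
      have hw : (b : K) + (c * (b ^ 2 ^ m)⁻¹ : Kˣ) ≠ 0 := fun h ↦ by
        rw [CharTwo.add_eq_zero, Units.val_inj, eq_mul_inv_iff_mul_eq] at h
        exact hb' (hinj _ _ (by rw [h, hσ]))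
      set w : Kˣ := Units.mk0 _ hw with hwdef
      have hσw : σ (w * w ^ 2 ^ m) = w := hinj _ _ (hσ _)
      have hwx : (w : K) * (1 + b / w) = (c * (b ^ 2 ^ m)⁻¹ : Kˣ) := by
        have : (w : K) * (1 + b / w) = w + b := by field_simp
        rw [this, hwdef, Units.val_mk0, add_comm, ← add_assoc, CharTwo.add_self_eq_zero, zero_add]
      have h1x : 1 + (1 + (b : K) / w) = b / w := by
        rw [← add_assoc, CharTwo.add_self_eq_zero, zero_add]
      refine ⟨⟨w * w ^ 2 ^ m, 1 + b / w⟩, ?_, ?_⟩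
      · simp only [Finset.mem_sigma, Finset.mem_univ, true_and, Finset.mem_filter]
        rw [h1x, Units.val_mul, Units.val_inv_eq_inv_val, eq_mul_inv_iff_mul_eq₀ (Units.ne_zero _)]
        rw [Units.val_mul, Units.val_inv_eq_inv_val, eq_mul_inv_iff_mul_eq₀ (Units.ne_zero _)] at hwx
        rw [← hwx]
        simp only [Units.val_mul, Units.val_pow_eq_pow_val, div_pow]
        field_simp
      · ext
        simp only [hσw, Units.val_mul, Units.val_mk0, h1x]
        field_simp
    · rintro ⟨y, x⟩ hp
      simp only [Finset.mem_sigma, Finset.mem_univ, true_and, Finset.mem_filter] at hp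
      rw [hkey y x hp _ rfl]
      congr 1
      simp only [Units.val_mul, Units.val_mk0]
      rw [mul_add, mul_one, add_assoc, CharTwo.add_self_eq_zero, add_zero]

/-- If a sign function deconvolves the Kloosterman sums, all fibre counts are `0` or `2`. -/
lemma fiberCard_eq_zero_or_two (m : ℕ) (σ : Kˣ →* Kˣ) (hσ : ∀ y, σ y * σ y ^ 2 ^ m = y)
    (hq : 2 < Fintype.card K) (ε : Kˣ → ℤ) (hε : ∀ c, ε c = 1 ∨ ε c = -1)
    (h : ∀ c : Kˣ, ∑ y : Kˣ, ε (c * y⁻¹) * traceChar K (σ y) = kloostermanSum c) (c : Kˣ) :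
    fiberCard m (c : K) = 0 ∨ fiberCard m (c : K) = 2 := by
  have hbij : Function.Bijective σ := Finite.injective_iff_bijective.1 fun x y hxy ↦ by
    rw [← hσ x, hxy, hσ]
  have hconst : ∀ a b : Kˣ, ε a - fiberCard m (a : K) = ε b - fiberCard m (b : K) := by
    -- The convolution of ε - n with χ ∘ σ is constantly 1, so inversion makes ε - n constant.
    have h1 : ∀ a : Kˣ, Fintype.card K * (ε a - fiberCard m (a : K)) =
        ∑ z : Kˣ, (ε z - fiberCard m (z : K)) - 1 := fun a ↦ by
      have h2 := sum_traceChar_mul_sum σ hbij (fun z : Kˣ ↦ ε z - fiberCard m (z : K)) a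
      have h3 : ∀ y : Kˣ, ∑ z : Kˣ, (ε (a * y * z⁻¹) - fiberCard m ((a * y * z⁻¹ : Kˣ) : K)) *
          traceChar K (σ z) = 1 := fun y ↦ by
        simp_rw [sub_mul]
        rw [Finset.sum_sub_distrib, h, kloostermanSum_eq_sum_fiberCard m σ hσ]
        ring
      simp_rw [h3, mul_one] at h2
      rw [hbij.sum_comp (fun y : Kˣ ↦ traceChar K y), sum_units_traceChar] at h2
      linarith
    intro a b
    have hq0 : (Fintype.card K : ℤ) ≠ 0 := by exact_mod_cast Fintype.card_ne_zero
    exact mul_left_cancel₀ hq0 ((h1 a).trans (h1 b).symm)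
  have hsum := sum_fiberCard (K := K) m
  have hcard : Fintype.card Kˣ = Fintype.card K - 1 := Fintype.card_units K
  -- The q - 1 counts add up to q - 2 > 0, so some vanish and some do not. Since counts differ by a
  -- difference of two signs, only 0 and 2 remain.
  obtain ⟨c₀, hc₀⟩ : ∃ c₀ : Kˣ, fiberCard m (c₀ : K) = 0 := by
    by_contra! hne
    have : ∑ c : Kˣ, 1 ≤ ∑ c : Kˣ, fiberCard m (c : K) :=
      Finset.sum_le_sum fun c _ ↦ Nat.one_le_iff_ne_zero.2 (hne c)
    rw [Finset.sum_const, Finset.card_univ, smul_eq_mul, mul_one] at this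
    omega
  obtain ⟨c₁, hc₁⟩ : ∃ c₁ : Kˣ, fiberCard m (c₁ : K) ≠ 0 := by
    by_contra! hz
    simp only [hz, Finset.sum_const_zero] at hsum
    omega
  have e0 := hε c₀
  have e1 := hε c₁
  have e2 := hε c
  have h1 := hconst c₁ c₀
  have h2 := hconst c c₀
  omega

/-- If all fibre counts are `0` or `2`, then the `2 ^ m`-power Frobenius map is the identity. -/
lemma pow_two_pow_eq_self_of_fiberCard (m : ℕ)
    (h : ∀ c : Kˣ, fiberCard m (c : K) = 0 ∨ fiberCard m (c : K) = 2) (t : K) :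
    t ^ 2 ^ m = t := by
  have hK : CharP K 2 := charP_two_of_algebra
  have h2 : (2 : K) = 0 := CharTwo.two_eq_zero
  have hadd : ∀ x y : K, (x + y) ^ 2 ^ m = x ^ 2 ^ m + y ^ 2 ^ m := fun x y ↦
    add_pow_char_pow x y 2 m
  by_contra ht
  have ht0 : t ≠ 0 := by rintro rfl; simp at ht
  obtain ⟨θ, hθ⟩ : ∃ θ, θ * t = t ^ 2 ^ m := ⟨t ^ 2 ^ m / t, by field_simp⟩
  have hθ0 : θ ≠ 0 := by
    rintro rfl
    rw [zero_mul] at hθ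
    exact pow_ne_zero _ ht0 hθ.symm
  have hθ1 : 1 + θ ≠ 0 := fun h ↦ by
    rw [CharTwo.add_eq_zero] at h
    rw [← h, one_mul] at hθ
    exact ht hθ.symm
  -- This y is chosen so that y/(1 + y) = θ.
  obtain ⟨y, hy⟩ : ∃ y, y * (1 + θ) = θ := ⟨θ / (1 + θ), by field_simp⟩
  have hy0 : y ≠ 0 := by rintro rfl; rw [zero_mul] at hy; exact hθ0 hy.symm
  have hy1 : 1 + y ≠ 0 := fun h ↦ by
    rw [CharTwo.add_eq_zero] at h
    rw [← h, one_mul] at hy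
    simp at hy
  have hyθ : (1 + y) * θ = y := by grind
  have hc0 : y * (1 + y) ^ 2 ^ m ≠ 0 := mul_ne_zero hy0 (pow_ne_zero _ hy1)
  have hN : fiberCard m (y * (1 + y) ^ 2 ^ m) = 2 := by
    refine (h (Units.mk0 _ hc0)).resolve_left fun h0 ↦ ?_
    rw [fiberCard, Finset.card_eq_zero] at h0
    exact Finset.notMem_empty y (h0 ▸ by simp)
  obtain ⟨x, hx, hxy⟩ : ∃ x, x * (1 + x) ^ 2 ^ m = y * (1 + y) ^ 2 ^ m ∧ x ≠ y := by
    obtain ⟨x, hx, hxy⟩ := Finset.exists_mem_ne (s := Finset.univ.filter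
      fun x : K ↦ x * (1 + x) ^ 2 ^ m = y * (1 + y) ^ 2 ^ m) (by rw [← fiberCard, hN]; simp) y
    exact ⟨x, by simpa using hx, hxy⟩
  have hxy' : x + y ≠ 0 := by rwa [Ne, CharTwo.add_eq_zero]
  -- This Möbius change of variable turns the fibre equation into the affine equation (1 + y)
  -- T^(2^m) = y (T + 1).
  obtain ⟨t₁, ht₁⟩ : ∃ t₁, t₁ * (x + y) = 1 + x := ⟨(1 + x) / (x + y), by field_simp⟩
  have ht₁Q : (1 + y) * t₁ ^ 2 ^ m = y * (t₁ + 1) := by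
    have h3 : t₁ ^ 2 ^ m * (x + y) ^ 2 ^ m = (1 + x) ^ 2 ^ m := by rw [← mul_pow, ht₁]
    have h4 : (x + y) ^ 2 ^ m = (1 + x) ^ 2 ^ m + (1 + y) ^ 2 ^ m := by
      rw [← hadd]; congr 1; grind
    have h5 : (x + y) ^ 2 ^ m ≠ 0 := pow_ne_zero _ hxy'
    apply mul_right_cancel₀ h5
    apply mul_right_cancel₀ hxy'
    generalize t₁ ^ 2 ^ m = T at *
    generalize (x + y) ^ 2 ^ m = A at *
    generalize (1 + x) ^ 2 ^ m = B at *
    generalize (1 + y) ^ 2 ^ m = C at *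
    grind
  -- As t^(2^m) = θ t, t solves the homogeneous equation, so t₁ + t is another solution.
  obtain ⟨t₂, ht₂⟩ : ∃ t₂, t₂ = t₁ + t := ⟨_, rfl⟩
  have ht₂Q : (1 + y) * t₂ ^ 2 ^ m = y * (t₂ + 1) := by
    rw [ht₂, hadd, mul_add, ht₁Q, ← hθ, ← mul_assoc, hyθ]; ring
  have ht₂1 : t₂ + 1 ≠ 0 := fun h ↦ by
    rw [h, mul_zero, mul_eq_zero, pow_eq_zero_iff (by simp)] at ht₂Q
    grind
  -- Undoing the change of variable yields a third point of the fibre.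
  obtain ⟨x₂, hx₂⟩ : ∃ x₂, (1 + x₂) * (t₂ + 1) = (1 + y) * t₂ :=
    ⟨1 + (1 + y) * t₂ / (t₂ + 1), by
      rw [← add_assoc, CharTwo.add_self_eq_zero, zero_add]; field_simp⟩
  have hx₂c : x₂ * (1 + x₂) ^ 2 ^ m = y * (1 + y) ^ 2 ^ m := by
    have h3 : (1 + x₂) ^ 2 ^ m * (t₂ ^ 2 ^ m + 1) = (1 + y) ^ 2 ^ m * t₂ ^ 2 ^ m := by
      rw [← mul_pow, ← hx₂, mul_pow, hadd t₂, one_pow]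
    have h5 : t₂ ^ 2 ^ m + 1 ≠ 0 := by
      rw [← one_pow (2 ^ m), ← hadd]; exact pow_ne_zero _ ht₂1
    apply mul_right_cancel₀ h5
    apply mul_right_cancel₀ ht₂1
    apply mul_right_cancel₀ hy1
    generalize t₂ ^ 2 ^ m = T at *
    generalize (1 + x₂) ^ 2 ^ m = B at *
    generalize (1 + y) ^ 2 ^ m = C at *
    have h6 : x₂ * (t₂ + 1) = 1 + y * t₂ := by grind
    linear_combination x₂ * (t₂ + 1) * (1 + y) * h3 + C * T * (1 + y) * h6 +
      (C * (1 + y * t₂) - y * C * (t₂ + 1)) * ht₂Q - y ^ 2 * C * (t₂ + 1) * h2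
  have hx₂y : x₂ ≠ y := by
    rintro rfl
    have := mul_left_cancel₀ hy1 hx₂
    simp at this
  have hx₂x : x₂ ≠ x := by
    rintro rfl
    grind
  have h3 : ({y, x, x₂} : Finset K).card ≤ fiberCard m (y * (1 + y) ^ 2 ^ m) := by
    refine Finset.card_le_card fun z hz ↦ ?_
    simp only [Finset.mem_insert, Finset.mem_singleton] at hz
    rcases hz with rfl | rfl | rfl <;> simp [hx, hx₂c]
  rw [hN, Finset.card_eq_three.2 ⟨y, x, x₂, hxy.symm, hx₂y.symm, hx₂x.symm, rfl⟩] at h3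
  omega

end fibers

/-! ### Multiplicative convolution and inverses of powers of two -/

/-- A multiplicative character turns multiplicative convolution into multiplication. -/
lemma sum_convolution_mul {G R : Type*} [CommGroup G] [Fintype G] [CommRing R] (T : G →* R)
    (f g : G → R) :
    ∑ c : G, (∑ y : G, f (c * y⁻¹) * g y) * T c⁻¹ =
      (∑ c : G, f c * T c⁻¹) * ∑ y : G, g y * T y⁻¹ := by
  rw [Finset.sum_mul_sum, Finset.sum_comm]
  simp_rw [Finset.sum_mul]
  rw [Finset.sum_comm]
  refine Finset.sum_congr rfl fun y _ ↦ ?_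
  rw [← Equiv.sum_comp (Equiv.mulRight y)]
  refine Finset.sum_congr rfl fun c _ ↦ ?_
  rw [Equiv.coe_mulRight, mul_inv_cancel_right, mul_inv, map_mul]
  ring

/-- An inverse of a power of two modulo `2 ^ k - 1` is a power of two. -/
lemma exists_eq_two_pow_of_mul_modEq {k s n : ℕ} (hs : s < 2 ^ k - 1)
    (h : s * 2 ^ n ≡ 1 [MOD 2 ^ k - 1]) (hs0 : 0 < s) : ∃ i < k, s = 2 ^ i := by
  have hk : 1 < k := by
    by_contra! hk
    interval_cases k <;> omega
  have h1 : 2 ^ k ≡ 1 [MOD 2 ^ k - 1] := Nat.modEq_sub Nat.one_le_two_pow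
  have hpow : ∀ a, (2 ^ k) ^ a ≡ 1 [MOD 2 ^ k - 1] := fun a ↦ by
    simpa using h1.pow a
  -- Since n + N = k n, 2^N inverts 2^n modulo 2^k - 1.
  set N := (k - 1) * n with hN
  refine ⟨N % k, Nat.mod_lt _ (by omega), ?_⟩
  have h2 : s ≡ 2 ^ N [MOD 2 ^ k - 1] := by
    have h3 : (2 ^ k) ^ n = 2 ^ n * 2 ^ N := by
      rw [← pow_mul, ← pow_add, hN]
      congr 1
      obtain ⟨k, rfl⟩ := Nat.exists_eq_add_of_lt hk
      simp only [Nat.add_sub_cancel]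
      ring
    calc s = s * 1 := (mul_one s).symm
      _ ≡ s * (2 ^ k) ^ n [MOD 2 ^ k - 1] := ((hpow n).symm).mul_left s
      _ = s * 2 ^ n * 2 ^ N := by rw [h3, mul_assoc]
      _ ≡ 1 * 2 ^ N [MOD 2 ^ k - 1] := h.mul_right _
      _ = 2 ^ N := one_mul _
  have h3 : 2 ^ N ≡ 2 ^ (N % k) [MOD 2 ^ k - 1] := by
    conv_lhs => rw [← Nat.div_add_mod N k, pow_add, pow_mul]
    simpa using (hpow (N / k)).mul_right (2 ^ (N % k))
  refine Nat.ModEq.eq_of_lt_of_lt (h2.trans h3) hs ?_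
  have h4 : 2 ^ (N % k) ≤ 2 ^ (k - 1) :=
    Nat.pow_le_pow_right two_pos (Nat.le_sub_one_of_lt (Nat.mod_lt _ (by omega)))
  have h5 : 2 ^ k = 2 * 2 ^ (k - 1) := by rw [← pow_succ']; congr 1; omega
  have h6 : 1 < 2 ^ (k - 1) := Nat.one_lt_two_pow (by omega)
  omega

/-! ### From the sign identity to the exponent -/

section main

variable {K : Type*} [Field K] [Algebra (ZMod 2) K] [Fintype K] [DecidableEq K]

/-- Stickelberger-type restriction: deconvolving the Kloosterman sums by a sign function forces
the inverse exponent to have binary weight at most two. -/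
lemma exists_pow_mul_eq_self (s : ℕ) (hK : ∃ y : Kˣ, y ≠ 1) (ε : Kˣ → ℤ)
    (h : ∀ c : Kˣ, ∑ y : Kˣ, ε (c * y⁻¹) * traceChar K (y ^ s : Kˣ) = kloostermanSum c) :
    ∃ i j : ℕ, i ≤ j ∧ ∀ y : Kˣ, y ^ (s * (2 ^ i + 2 ^ j)) = y := by
  have h2 : CharP K 2 := charP_two_of_algebra
  suffices ∃ i j : ℕ, ∀ y : Kˣ, y ^ (s * (2 ^ i + 2 ^ j)) = y by
    obtain ⟨i, j, hij⟩ := this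
    rcases le_total i j with hle | hle
    · exact ⟨i, j, hle, hij⟩
    · exact ⟨j, i, hle, fun y ↦ by rw [add_comm]; exact hij y⟩
  by_contra! hne
  obtain ⟨r, hr⟩ := eight_dvd_sum s hK hne
  have h3 := sum_convolution_mul (teichmullerUnits K) (fun y ↦ (ε y : WittVector 2 K))
    (fun y ↦ (traceChar K (y ^ s : Kˣ) : WittVector 2 K))
  have h4 := sum_convolution_mul (teichmullerUnits K)
    (fun y ↦ (traceChar K y : WittVector 2 K)) (fun y ↦ (traceChar K y : WittVector 2 K))
  have h5 : ∀ c : Kˣ, ∑ y : Kˣ, (ε (c * y⁻¹) : WittVector 2 K) * traceChar K (y ^ s : Kˣ) =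
      ∑ y : Kˣ, (traceChar K (c * y⁻¹ : Kˣ) : WittVector 2 K) * traceChar K y := fun c ↦ by
    have := congrArg (Int.cast : ℤ → WittVector 2 K) (h c)
    rw [kloostermanSum] at this
    push_cast at this
    simpa [mul_comm] using this
  simp_rw [h5] at h3
  rw [h4, hr, ← sq] at h3
  exact not_eight_dvd_sum_sq hK _ (h3.trans (mul_left_comm _ _ _))

/-- The exponent of a deconvolution of the Kloosterman sums is a power of two. -/
lemma exists_eq_two_pow_of_sum_eq_kloostermanSum {k s : ℕ} (hcard : Fintype.card K = 2 ^ k)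
    (hs0 : 0 < s) (hs : s < 2 ^ k - 1) (ε : Kˣ → ℤ) (hε : ∀ c, ε c = 1 ∨ ε c = -1)
    (h : ∀ c : Kˣ, ∑ y : Kˣ, ε (c * y⁻¹) * traceChar K (y ^ s : Kˣ) = kloostermanSum c) :
    ∃ i < k, s = 2 ^ i := by
  have hunits : Fintype.card Kˣ = 2 ^ k - 1 := by rw [Fintype.card_units, hcard]
  have : Nontrivial Kˣ := Fintype.one_lt_card_iff_nontrivial.1 (by omega)
  obtain ⟨i, j, hij, hpow⟩ := exists_pow_mul_eq_self s (exists_ne 1) ε h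
  -- Factoring 2^i + 2^j = 2^i (1 + 2^(j-i)) gives σ; the factor 2^i is invisible to χ.
  have hσ : ∀ y : Kˣ, (powMonoidHom (s * 2 ^ i) : Kˣ →* Kˣ) y *
      (powMonoidHom (s * 2 ^ i) : Kˣ →* Kˣ) y ^ 2 ^ (j - i) = y := fun y ↦ by
    rw [powMonoidHom_apply, ← pow_mul, ← pow_add, mul_assoc, ← pow_add, Nat.add_sub_cancel' hij,
      ← mul_add, hpow]
  have hχ : ∀ y : Kˣ, traceChar K ((powMonoidHom (s * 2 ^ i) : Kˣ →* Kˣ) y : Kˣ) =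
      traceChar K (y ^ s : Kˣ) := fun y ↦ by
    rw [powMonoidHom_apply, pow_mul, Units.val_pow_eq_pow_val, traceChar_pow_two_pow]
  have hfrob := pow_two_pow_eq_self_of_fiberCard (j - i)
    (fiberCard_eq_zero_or_two (j - i) _ hσ (by omega) ε hε (by simpa only [hχ] using h))
  have hmod : ∀ y : Kˣ, y ^ (s * 2 ^ (i + 1)) = y ^ 1 := fun y ↦ by
    have h1 := hσ y
    have h2 : (powMonoidHom (s * 2 ^ i) : Kˣ →* Kˣ) y ^ 2 ^ (j - i) =
        (powMonoidHom (s * 2 ^ i) : Kˣ →* Kˣ) y := Units.ext (by simpa using hfrob _)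
    rw [h2, powMonoidHom_apply, ← pow_add] at h1
    rw [pow_one, pow_succ, ← mul_assoc, mul_two, h1]
  obtain ⟨g, hg⟩ := IsCyclic.exists_generator (α := Kˣ)
  have h3 := pow_eq_pow_iff_modEq.1 (hmod g)
  rw [orderOf_eq_card_of_forall_mem_zpowers hg, Nat.card_eq_fintype_card, hunits] at h3
  exact exists_eq_two_pow_of_mul_modEq hs h3 hs0

end main

theorem mainTheorem5 {F : Type*} [Field F] [Fintype F] [Algebra (ZMod 2) F]
    (k s d : ℕ) (hF : Fintype.card F = 2 ^ (2 * k))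
    (hd : d = (2 ^ k + 1) * s) (hs_pos : 0 < s) (hs_lt : s < 2 ^ k - 1)
    (hs_coprime : Nat.gcd s (2 ^ k - 1) = 1)
    (hs_pow : ∀ i : ℕ, i < k → s ≠ 2 ^ i) (α : F) :
    ¬ IsBent (fun x : F => Algebra.trace (ZMod 2) F (α * x ^ d)) := by
  classical
  intro hbent
  have hk : k ≠ 0 := by rintro rfl; simp at hs_lt
  have : Fintype (GaloisField 2 k) := Fintype.ofFinite _
  have hfinF : Module.finrank (ZMod 2) F = 2 * k :=
    Nat.pow_right_injective le_rfl ((FiniteField.pow_finrank_eq_card 2 F).trans hF)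
  have hfinK : Module.finrank (ZMod 2) (GaloisField 2 k) = k := GaloisField.finrank 2 hk
  have hcardK : Fintype.card (GaloisField 2 k) = 2 ^ k := by
    rw [← FiniteField.pow_finrank_eq_card 2, hfinK]
  obtain ⟨φ⟩ := FiniteField.nonempty_algHom_of_finrank_dvd (F := ZMod 2)
    (K := GaloisField 2 k) (L := F) (by rw [hfinF, hfinK]; exact dvd_mul_left k 2)
  -- The Galois field plays the role of the subfield with 2^k elements.
  let _ : Algebra (GaloisField 2 k) F := φ.toRingHom.toAlgebra
  have hKF : Module.finrank (GaloisField 2 k) F = 2 := by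
    have h1 := Module.card_eq_pow_finrank (K := GaloisField 2 k) (V := F)
    rw [hF, hcardK, ← pow_mul, mul_comm 2 k] at h1
    exact (Nat.eq_of_mul_eq_mul_left (Nat.pos_of_ne_zero hk)
      (Nat.pow_right_injective le_rfl h1)).symm
  have hbij : Function.Bijective (powMonoidHom s : (GaloisField 2 k)ˣ →* (GaloisField 2 k)ˣ) := by
    have hc : (Nat.card (GaloisField 2 k)ˣ).Coprime s := by
      rw [Nat.card_eq_fintype_card, Fintype.card_units, hcardK, Nat.coprime_comm]
      exact hs_coprime
    exact (powCoprime hc).bijective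
  have hpow : (2 : ℝ) ^ ((Module.finrank (ZMod 2) F : ℝ) / 2) =
      ((Fintype.card (GaloisField 2 k) : ℤ) : ℝ) := by
    rw [hfinF, hcardK]
    push_cast
    rw [mul_div_cancel_left₀ _ (two_ne_zero), Real.rpow_natCast]
  subst hd
  obtain ⟨ε, hε, h⟩ := exists_sign_of_bent hKF α s hs_pos.ne' hbij fun l ↦ by
    have h1 := hbent l
    rw [hpow] at h1
    rw [hcardK] at h1 ⊢
    exact_mod_cast h1
  obtain ⟨i, hi, hsi⟩ := exists_eq_two_pow_of_sum_eq_kloostermanSum hcardK hs_pos hs_lt ε hε h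
  exact hs_pow i hi hsi
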